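/- Let $n\ge 2$ be an integer, and let $e_{ij}$ ($0\le i,j\le n$) be the matrix units of $\mathfrak{gl}_{n+1}(\mathbb C)$. In $\mathfrak{sl}_{n+1}=\mathfrak{sl}_{n+1}(\mathbb C)$ put $h_i=e_{ii}-\frac1{n+1}\sum_{k=0}^n e_{kk}$ for $1\le i\le n$, and let $e=e_{10}+\dots+e_{n0}$, a minimal nilpotent element. Let $\mathfrak g(-2)=\bigoplus_{i=1}^n\mathbb C e_{0i}$ with the character $\theta(X)=\operatorname{tr}(Xe)$ (so $\theta(e_{0i})=1$), let $$Q_{\mathbf 1}=U(\mathfrak{sl}_{n+1})\otimes_{U(\mathfrak g(-2))}\mathbb C_\theta\cong U(\mathfrak{sl}_{n+1})\Big/\sum_{i=1}^n U(\mathfrak{sl}_{n+1})(e_{0i}-1),$$ and let $W(e)=\operatorname{End}_{\mathfrak{sl}_{n+1}}(Q_{\mathbf 1})^{\mathrm{op}}$ be Premet's finite $W$-algebra. Let $U_S$ be the localization of $U(\mathfrak{sl}_{n+1})$ at the Ore set $S=\{e_{01}^{i_1}\cdots e_{0n}^{i_n}\mid i_1,\dots,i_n\in\mathbb Z_{\ge0}\}$,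 let $B$ be the subalgebra of $U_S$ generated by $h_i,\,e_{0k},\,e_{0k}^{-1}$ ($1\le i,k\le n$), and let $W$ be the centralizer of $B$ in $U_S$. Then $W$ and $W(e)$ are isomorphic as $\mathbb C$-algebras. -/

import Mathlib

noncomputable section

namespace MinimalWAlgebra

open LieAlgebra.SpecialLinear

attribute [local instance 100] LieRing.ofAssociativeRing

/-! ### A criterion for the Ore condition -/

section Ore

variable {R : Type*} [Ring R]

/-- The inner derivation `r ↦ a r - r a`. -/
def adMap (a : R) : R →+ R := AddMonoidHom.mulLeft a - AddMonoidHom.mulRight a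

theorem adMap_apply (a r : R) : adMap a r = a * r - r * a := rfl

/-- `a` acts locally nilpotently on `R` through its inner derivation. -/
def AdLocNilp (a : R) : Prop := ∀ r : R, ∃ m : ℕ, (adMap a)^[m] r = 0

theorem adMap_mul (a x y : R) : adMap a (x * y) = adMap a x * y + x * adMap a y := by
  simp only [adMap_apply]; noncomm_ring

theorem iterate_adMap_mul (a : R) (N : ℕ) : ∀ (p q : ℕ) (x y : R), p + q = N →
    (adMap a)^[p] x = 0 → (adMap a)^[q] y = 0 → (adMap a)^[N] (x * y) = 0 := by
  induction N with
  | zero =>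
    intro p q x y h hx _
    obtain rfl : p = 0 := by omega
    simp only [Function.iterate_zero, id_eq] at hx ⊢
    simp [hx]
  | succ N ih =>
    intro p q x y h hx hy
    rw [Function.iterate_succ_apply, adMap_mul, iterate_map_add]
    rcases p with _ | p
    · simp only [Function.iterate_zero, id_eq] at hx
      simp [hx, iterate_map_zero]
    rcases q with _ | q
    · simp only [Function.iterate_zero, id_eq] at hy
      simp [hy, iterate_map_zero]
    rw [ih p (q + 1) _ _ (by omega) hx hy, ih (p + 1) q _ _ (by omega) hx hy, add_zero]

theorem iterate_adMap_mono (a : R) {m k : ℕ} (h : m ≤ k) {x : R}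
    (hx : (adMap a)^[m] x = 0) : (adMap a)^[k] x = 0 := by
  obtain ⟨d, rfl⟩ := Nat.exists_eq_add_of_le h
  rw [add_comm, Function.iterate_add_apply, hx, iterate_map_zero]

theorem exists_pow_mul_eq (a : R) (m : ℕ) : ∀ r : R, (adMap a)^[m] r = 0 →
    ∃ u : R, a ^ m * r = u * a := by
  induction m with
  | zero => intro r hr; exact ⟨0, by simpa using hr⟩
  | succ m ih =>
    intro r hr
    obtain ⟨u, hu⟩ := ih _ (by simpa [Function.iterate_succ_apply] using hr)
    refine ⟨a ^ m * r + u, ?_⟩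
    rw [add_mul, ← hu, adMap_apply, pow_succ]
    noncomm_ring

theorem iterate_adMap_of_mul_eq_zero (a r : R) (h : r * a = 0) (m : ℕ) :
    (adMap a)^[m] r = a ^ m * r := by
  induction m with
  | zero => simp
  | succ m ih =>
    rw [Function.iterate_succ_apply', ih, adMap_apply, mul_assoc _ r, h, pow_succ']
    noncomm_ring

/-- A submonoid generated by locally ad-nilpotent elements satisfies the Ore condition. -/
theorem nonempty_oreSet (T : Set R) (hT : ∀ a ∈ T, AdLocNilp a) :
    Nonempty (OreLocalization.OreSet (Submonoid.closure T)) := by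
  rw [OreLocalization.nonempty_oreSet_iff]
  have key : ∀ s ∈ Submonoid.closure T,
      (∀ r : R, r * s = 0 → ∃ s' ∈ Submonoid.closure T, s' * r = 0) ∧
      (∀ r : R, ∃ r' : R, ∃ s' ∈ Submonoid.closure T, s' * r = r' * s) := by
    intro s hs
    induction hs using Submonoid.closure_induction with
    | mem a ha =>
      have ha' := Submonoid.subset_closure (M := R) ha
      constructor
      · intro r hr
        obtain ⟨m, hm⟩ := hT a ha r
        exact ⟨a ^ m, pow_mem ha' m, by rw [← iterate_adMap_of_mul_eq_zero a r hr m, hm]⟩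
      · intro r
        obtain ⟨m, hm⟩ := hT a ha r
        obtain ⟨u, hu⟩ := exists_pow_mul_eq a m r hm
        exact ⟨u, a ^ m, pow_mem ha' m, hu⟩
    | one =>
      exact ⟨fun r hr => ⟨1, one_mem _, by simpa using hr⟩,
        fun r => ⟨r, 1, one_mem _, by simp⟩⟩
    | mul s t _ _ ihs iht =>
      constructor
      · intro r hr
        obtain ⟨t', ht', h1⟩ := iht.1 (r * s) (by rw [mul_assoc, hr])
        obtain ⟨s', hs', h2⟩ := ihs.1 (t' * r) (by rw [mul_assoc, h1])
        exact ⟨s' * t', mul_mem hs' ht', by rw [mul_assoc, h2]⟩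
      · intro r
        obtain ⟨r', t', ht', h1⟩ := iht.2 r
        obtain ⟨r'', s', hs', h2⟩ := ihs.2 r'
        exact ⟨r'', s' * t', mul_mem hs' ht', by
          rw [mul_assoc, h1, ← mul_assoc, h2, mul_assoc]⟩
  constructor
  · rintro r₁ r₂ ⟨s, hs⟩ h
    obtain ⟨s', hs', h'⟩ := (key s hs).1 (r₁ - r₂) (by rw [sub_mul, sub_eq_zero]; exact h)
    exact ⟨⟨s', hs'⟩, by rwa [mul_sub, sub_eq_zero] at h'⟩
  · rintro r ⟨s, hs⟩
    obtain ⟨r', s', hs', h'⟩ := (key s hs).2 r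
    exact ⟨r', ⟨s', hs'⟩, h'⟩

end Ore

/-! ### The Lie algebra `sl_{n+1}` over `ℂ` and its enveloping algebra

Rows and columns are indexed by `Fin (n + 1) = {0, 1, …, n}`; the index `i ∈ {1, …, n}` is
written `i.succ` with `i : Fin n`. -/

/-- The complex Lie algebra `sl_{n+1}`. -/
abbrev SL (n : ℕ) : Type := sl (Fin (n + 1)) ℂ

/-- The enveloping algebra `U(sl_{n+1})`. -/
abbrev U (n : ℕ) : Type := UniversalEnvelopingAlgebra ℂ (SL n)

/-- The canonical map `sl_{n+1} → U(sl_{n+1})`. -/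
abbrev toU (n : ℕ) : SL n →ₗ⁅ℂ⁆ U n := UniversalEnvelopingAlgebra.ι ℂ

/-- The matrix unit `e_{0i}`, `1 ≤ i ≤ n`. -/
def e0 {n : ℕ} (i : Fin n) : SL n := single 0 i.succ (Fin.succ_ne_zero i).symm 1

/-- The matrix unit `e_{i0}`, `1 ≤ i ≤ n`. -/
def f0 {n : ℕ} (i : Fin n) : SL n := single i.succ 0 (Fin.succ_ne_zero i) 1

/-- `h_i = e_{ii} - (1 / (n + 1)) I_{n+1}`, `1 ≤ i ≤ n`. -/
def h {n : ℕ} (i : Fin n) : SL n :=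
  ⟨Matrix.single i.succ i.succ (1 : ℂ) - ((n : ℂ) + 1)⁻¹ • (1 : Matrix (Fin (n + 1)) _ ℂ), by
    have hn : (n : ℂ) + 1 ≠ 0 := by exact_mod_cast Nat.succ_ne_zero n
    refine LinearMap.mem_ker.2 ?_
    simp [Matrix.trace_sub, Matrix.trace_smul, Matrix.trace_single_eq_same, hn]⟩

/-- The minimal nilpotent element `e = e_{10} + ⋯ + e_{n0}`. -/
def e (n : ℕ) : SL n := ∑ i : Fin n, f0 i

/-! ### The finite `W`-algebra of `e` -/

/-- The graded piece `g(-2) = ⊕ ℂ e_{0i}`, `1 ≤ i ≤ n`. -/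
def gNeg (n : ℕ) : Submodule ℂ (SL n) := Submodule.span ℂ (Set.range e0)

/-- The linear form `X ↦ tr (X e)`; its restriction to `g(-2)` is the character `θ`. -/
def theta (n : ℕ) : SL n →ₗ[ℂ] ℂ where
  toFun X := Matrix.trace (X.val * (e n).val)
  map_add' X Y := by simp [add_mul, Matrix.trace_add]
  map_smul' c X := by simp [Matrix.trace_smul]

/-- The left ideal of `U(sl_{n+1})` generated by all `X - θ(X)` with `X ∈ g(-2)`. -/
def whittakerIdeal (n : ℕ) : Submodule (U n) (U n) :=
  Submodule.span (U n)
    {u | ∃ X ∈ gNeg n, u = toU n X - algebraMap ℂ (U n) (theta n X)}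

theorem theta_e0 {n : ℕ} (i : Fin n) : theta n (e0 i) = 1 := by
  have : (e n).val = ∑ j : Fin n, (f0 j).val := by
    simp [e]
  simp only [theta, LinearMap.coe_mk, AddHom.coe_mk, this, Finset.mul_sum, Matrix.trace_sum]
  rw [Finset.sum_eq_single i]
  · simp [e0, f0]
  · intro j _ hj
    have : i.succ ≠ j.succ := fun h => hj (Fin.succ_injective n h).symm
    simp [e0, f0, Matrix.single_mul_single_of_ne _ _ _ _ this]
  · simp

/-- The left ideal is generated by `e_{01} - 1, …, e_{0n} - 1`. -/
theorem whittakerIdeal_eq (n : ℕ) : whittakerIdeal n =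
    Submodule.span (U n) (Set.range fun i : Fin n => toU n (e0 i) - 1) := by
  apply le_antisymm
  · refine Submodule.span_le.2 ?_
    rintro _ ⟨X, hX, rfl⟩
    have key : gNeg n ≤ ((Submodule.span (U n)
        (Set.range fun i : Fin n => toU n (e0 i) - 1)).restrictScalars ℂ).comap
        ((toU n : SL n →ₗ[ℂ] U n) - (Algebra.linearMap ℂ (U n)).comp (theta n)) := by
      refine Submodule.span_le.2 ?_
      rintro _ ⟨i, rfl⟩
      have : toU n (e0 i) - 1 ∈ Submodule.span (U n)
        (Set.range fun i : Fin n => toU n (e0 i) - 1) := Submodule.subset_span ⟨i, rfl⟩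
      simpa [theta_e0] using this
    exact key hX
  · refine Submodule.span_le.2 ?_
    rintro _ ⟨i, rfl⟩
    refine Submodule.subset_span ⟨e0 i, Submodule.subset_span ⟨i, rfl⟩, ?_⟩
    simp [theta_e0]

/-- The generalized Gelfand–Graev module `U(sl_{n+1}) ⊗_{U(g(-2))} ℂ_θ`, realized as the quotient
of `U(sl_{n+1})` by the left ideal generated by the kernel of the character `θ` on `U(g(-2))`. -/
abbrev Q (n : ℕ) : Type := U n ⧸ whittakerIdeal n

/-- The finite `W`-algebra `W(e) = End_{sl_{n+1}}(Q)^op`. -/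
abbrev FiniteW (n : ℕ) : Type := (Module.End (U n) (Q n))ᵐᵒᵖ

/-! ### The localization and the centralizer -/

/-- The multiplicative set of all monomials `e_{01}^{i_1} ⋯ e_{0n}^{i_n}`: since the `e_{0i}`
commute, it is the submonoid of `U(sl_{n+1})` that they generate. -/
def S (n : ℕ) : Submonoid (U n) := Submonoid.closure (Set.range fun i : Fin n => toU n (e0 i))

theorem lie_e0_e0 {n : ℕ} (i j : Fin n) : ⁅e0 i, e0 j⁆ = 0 := by
  apply Subtype.ext
  rw [sl_bracket]
  simp [e0, Matrix.single_mul_single_of_ne, Fin.succ_ne_zero]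

theorem ad_e0_cube {n : ℕ} (i : Fin n) (X : SL n) : ⁅e0 i, ⁅e0 i, ⁅e0 i, X⁆⁆⁆ = 0 := by
  have hsq : (e0 i).val * (e0 i).val = 0 := by
    simp [e0, Matrix.single_mul_single_of_ne, Fin.succ_ne_zero]
  apply Subtype.ext
  simp only [sl_bracket]
  generalize (e0 i).val = a at hsq ⊢
  generalize X.val = x
  have h1 : a * (a * x) = 0 := by rw [← mul_assoc, hsq, zero_mul]
  have h2 : ∀ y, a * (a * y) = 0 := fun y => by rw [← mul_assoc, hsq, zero_mul]
  simp [mul_sub, sub_mul, mul_assoc, h2, hsq]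

theorem adLocNilp_e0 {n : ℕ} (i : Fin n) : AdLocNilp (toU n (e0 i)) := by
  set a := toU n (e0 i) with ha
  let A : Subalgebra ℂ (U n) :=
    { carrier := {r | ∃ m : ℕ, (adMap a)^[m] r = 0}
      mul_mem' := by
        rintro x y ⟨p, hp⟩ ⟨q, hq⟩
        exact ⟨p + q, iterate_adMap_mul a _ p q x y rfl hp hq⟩
      add_mem' := by
        rintro x y ⟨p, hp⟩ ⟨q, hq⟩
        refine ⟨p + q, ?_⟩
        rw [iterate_map_add, iterate_adMap_mono a (Nat.le_add_right p q) hp,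
          iterate_adMap_mono a (Nat.le_add_left q p) hq, add_zero]
      algebraMap_mem' := fun c => ⟨1, by simp [adMap_apply, Algebra.commutes]⟩ }
  have hι : ∀ X : SL n, toU n X ∈ A := by
    intro X
    refine ⟨3, ?_⟩
    have : ∀ Y : SL n, adMap a (toU n Y) = toU n ⁅e0 i, Y⁆ := by
      intro Y; rw [LieHom.map_lie]; rfl
    simp only [Function.iterate_succ, Function.iterate_zero, Function.comp_apply, id_eq, this,
      ad_e0_cube, map_zero]
  let F : U n →ₐ[ℂ] A := UniversalEnvelopingAlgebra.lift ℂ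
    { toFun := fun X => ⟨toU n X, hι X⟩
      map_add' := fun X Y => Subtype.ext (map_add (toU n) X Y)
      map_smul' := fun c X => Subtype.ext (map_smul (toU n) c X)
      map_lie' := fun {X Y} => Subtype.ext (LieHom.map_lie (toU n) X Y) }
  have hF : A.val.comp F = AlgHom.id ℂ (U n) := by
    apply UniversalEnvelopingAlgebra.hom_ext
    ext X
    simp only [LieHom.coe_comp, Function.comp_apply, AlgHom.coe_toLieHom, AlgHom.coe_comp]
    rw [UniversalEnvelopingAlgebra.lift_ι_apply]
    rfl
  intro r
  have hr : ((F r : A) : U n) = r := DFunLike.congr_fun hF r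
  rw [← hr]
  exact (F r).2

instance oreSetS (n : ℕ) : OreLocalization.OreSet (S n) :=
  Classical.choice (nonempty_oreSet _ (by rintro _ ⟨i, rfl⟩; exact adLocNilp_e0 i))

/-- The Ore localization `U_S` of `U(sl_{n+1})` at `S`. -/
abbrev US (n : ℕ) : Type := OreLocalization (S n) (U n)

/-- The canonical map `sl_{n+1} → U_S`. -/
def toUS {n : ℕ} (X : SL n) : US n := OreLocalization.numeratorHom (toU n X)

/-- The inverse `e_{0k}^{-1}` in `U_S`. -/
def e0inv {n : ℕ} (k : Fin n) : US n :=
  OreLocalization.oreDiv 1 ⟨toU n (e0 k), Submonoid.subset_closure ⟨k, rfl⟩⟩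

theorem e0inv_mul {n : ℕ} (k : Fin n) : e0inv k * toUS (e0 k) = 1 :=
  OreLocalization.mul_inv (1 : S n)
    (⟨toU n (e0 k), Submonoid.subset_closure ⟨k, rfl⟩⟩ : S n)

theorem mul_e0inv {n : ℕ} (k : Fin n) : toUS (e0 k) * e0inv k = 1 :=
  OreLocalization.mul_inv
    (⟨toU n (e0 k), Submonoid.subset_closure ⟨k, rfl⟩⟩ : S n) (1 : S n)

/-- The subalgebra `B` of `U_S` generated by `h_i`, `e_{0k}`, `e_{0k}^{-1}`, `1 ≤ i, k ≤ n`. -/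
def B (n : ℕ) : Subalgebra ℂ (US n) :=
  Algebra.adjoin ℂ
    (Set.range (fun i : Fin n => toUS (h i)) ∪ Set.range (fun k : Fin n => toUS (e0 k)) ∪
      Set.range (fun k : Fin n => e0inv k))

/-- The centralizer `W` of `B` in `U_S`. -/
def W (n : ℕ) : Subalgebra ℂ (US n) := Subalgebra.centralizer ℂ (B n : Set (US n))

end MinimalWAlgebra

end

noncomputable section

namespace MinimalWAlgebra

open LieAlgebra.SpecialLinear

attribute [local instance 100] LieRing.ofAssociativeRing

/-! ### Weight gradings and slices in an associative algebra -/

section Slice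

variable {𝕜 R : Type*} [Field 𝕜] [Ring R] [Algebra 𝕜 R]

/-! An endomorphism of `Q` is determined by the image of the generator `whit`, which may be any
Whittaker vector, that is, any vector fixed by all e_{0i}. Each e_{0i} acts bijectively on `Q`,
since e_{0i} - 1 is locally nilpotent there; so `Q` becomes a U_S-module, and every w in W gives a
Whittaker vector w • `whit`. The point is that each Whittaker vector arises from exactly one w.

In U_S the derivation ad h_i is diagonalizable with integral eigenvalues, and u_i = e_{0i} is a unit
of weight -1. Sending x of weight k to x u_i^k therefore projects U_S onto the centralizer of h_i
along U_S (u_i - 1) (`exists_linearMap_centralizer`).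

Injectivity: the annihilator of `whit` in U_S is the left ideal generated by the u_i - 1
(`mem_span_of_smul_whit_eq_zero`), and the projections show that it meets the centralizer of the h_i
in 0 (`eq_zero_of_commute_of_mem_span`).

Surjectivity: y_i = h_i u_i⁻¹ satisfies [u_i, y_i] = 1, so `slice` along y_i moves a representative
of a Whittaker vector into the centralizer of the u_i without changing the vector; the projections
then make it commute with the h_i as well (`exists_commute_smul_eq`). -/

theorem adMap_smul (a : R) (c : 𝕜) (x : R) : adMap a (c • x) = c • adMap a x := by
  simp [adMap_apply, smul_sub]

theorem adMap_eq_zero_iff {a x : R} : adMap a x = 0 ↔ Commute a x := by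
  rw [adMap_apply, sub_eq_zero]; rfl

theorem Commute.adMap_right {a b x : R} (hab : Commute b a) (hx : Commute b x) :
    Commute b (adMap a x) := by
  rw [adMap_apply]
  exact (hab.mul_right hx).sub_right (hx.mul_right hab)

theorem Commute.iterate_adMap_right {a b x : R} (hab : Commute b a) (hx : Commute b x) (m : ℕ) :
    Commute b ((adMap a)^[m] x) := by
  induction m with
  | zero => exact hx
  | succ m ih => rw [Function.iterate_succ_apply']; exact Commute.adMap_right hab ih

theorem adMap_pow_of_adMap_eq_one {a y : R} (hy : adMap a y = 1) (m : ℕ) :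
    adMap a (y ^ (m + 1)) = ((m : R) + 1) * y ^ m := by
  induction m with
  | zero => simp [hy]
  | succ m ih =>
    rw [pow_succ, adMap_mul, ih, hy, mul_one, mul_assoc, ← pow_succ]
    push_cast
    rw [add_mul ((m : R) + 1), one_mul]

variable (𝕜) in
/-- The truncated Taylor expansion `∑_{j ≤ N} (-1)^j / j! • y^j (ad a)^j(x)`. When `[a, y] = 1`
and `(ad a)^(N + 1) x = 0`, it projects `x` to the centralizer of `a`. -/
def slice (a y : R) (N : ℕ) (x : R) : R :=
  ∑ j ∈ Finset.range (N + 1), ((-1) ^ j * ((j.factorial : 𝕜))⁻¹) • (y ^ j * (adMap a)^[j] x)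

/-- The sum telescopes: differentiating y^(j+1) cancels the term in which ad a hits the j-th
iterate. Only the top term survives, and it vanishes once (ad a)^(N+1) x = 0. -/
theorem adMap_slice [CharZero 𝕜] {a y : R} (hy : adMap a y = 1) (N : ℕ) (x : R) :
    adMap a (slice 𝕜 a y N x) =
      ((-1) ^ N * ((N.factorial : 𝕜))⁻¹) • (y ^ N * (adMap a)^[N + 1] x) := by
  induction N with
  | zero => simp [slice]
  | succ N ih =>
    rw [slice, Finset.sum_range_succ, map_add, ← slice, ih, adMap_smul, adMap_mul,
      adMap_pow_of_adMap_eq_one hy, ← Function.iterate_succ_apply' (adMap a) (N + 1) x, smul_add,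
      ← add_assoc]
    have h1 : ((N : R) + 1) * y ^ N * (adMap a)^[N + 1] x =
        ((N : 𝕜) + 1) • (y ^ N * (adMap a)^[N + 1] x) := by
      rw [Algebra.smul_def]
      simp [mul_assoc]
    have h2 : (-1) ^ (N + 1) * (((N + 1).factorial : 𝕜))⁻¹ * ((N : 𝕜) + 1) =
        -((-1) ^ N * ((N.factorial : 𝕜))⁻¹) := by
      have : (N : 𝕜) + 1 ≠ 0 := by exact_mod_cast Nat.succ_ne_zero N
      rw [Nat.factorial_succ]
      push_cast
      field_simp
      ring
    rw [h1, smul_smul, h2, neg_smul, add_neg_cancel, zero_add]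

theorem commute_slice {a y b x : R} (ha : Commute b a) (hy : Commute b y) (hx : Commute b x)
    (N : ℕ) : Commute b (slice 𝕜 a y N x) :=
  Commute.sum_right _ _ _ fun j _ =>
    ((hy.pow_right j).mul_right (Commute.iterate_adMap_right ha hx j)).smul_right _

/-- If a fixes both m and x • m, then (ad a)^j x kills m for every j ≥ 1. As the powers of y stand
on the left, only the term j = 0 acts on m. -/
theorem slice_smul {M : Type*} [AddCommGroup M] [Module R M] {a x : R} {m : M}
    (ham : a • m = m) (hx : a • x • m = x • m) (y : R) (N : ℕ) : slice 𝕜 a y N x • m = x • m := by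
  have h0 (j : ℕ) : (adMap a)^[j + 1] x • m = 0 := by
    induction j with
    | zero => simp [adMap_apply, sub_smul, mul_smul, ham, hx]
    | succ j ih =>
      rw [Function.iterate_succ_apply', adMap_apply, sub_smul, mul_smul, mul_smul, ham, ih,
        smul_zero, sub_zero]
  rw [slice, Finset.sum_range_succ', add_smul, Finset.sum_smul, Finset.sum_eq_zero, zero_add]
  · simp
  · intro j _
    rw [Algebra.smul_def, mul_smul, mul_smul, h0, smul_zero, smul_zero]

end Slice

/-! ### Weight decompositions and the projection onto a centralizer -/

section Weights

variable {𝕜 R : Type*} [Field 𝕜] [Ring R] [Algebra 𝕜 R]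

variable (𝕜) in
/-- The elements of weight `k` for the inner derivation of `a`. -/
def weightSpace (a : R) (k : ℤ) : Submodule 𝕜 R :=
  Module.End.eigenspace (LinearMap.mulLeft 𝕜 a - LinearMap.mulRight 𝕜 a) (k : 𝕜)

theorem mem_weightSpace {a : R} {k : ℤ} {x : R} :
    x ∈ weightSpace 𝕜 a k ↔ a * x - x * a = (k : 𝕜) • x := by
  simp [weightSpace]

theorem mul_mem_weightSpace {a : R} {k l : ℤ} {x y : R} (hx : x ∈ weightSpace 𝕜 a k)
    (hy : y ∈ weightSpace 𝕜 a l) : x * y ∈ weightSpace 𝕜 a (k + l) := by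
  rw [mem_weightSpace] at *
  have : a * (x * y) - x * y * a = (a * x - x * a) * y + x * (a * y - y * a) := by noncomm_ring
  rw [this, hx, hy, smul_mul_assoc, mul_smul_comm, ← add_smul, Int.cast_add]

theorem mem_weightSpace_zero {a x : R} : x ∈ weightSpace 𝕜 a 0 ↔ Commute a x := by
  simp [mem_weightSpace, sub_eq_zero, Commute, SemiconjBy]

theorem inv_mem_weightSpace {a : R} {k : ℤ} {u : Rˣ} (hu : (u : R) ∈ weightSpace 𝕜 a k) :
    (↑u⁻¹ : R) ∈ weightSpace 𝕜 a (-k) := by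
  rw [mem_weightSpace] at *
  have : a * (↑u⁻¹ : R) - ↑u⁻¹ * a = -(↑u⁻¹ * (a * u - u * a) * ↑u⁻¹ : R) := by
    simp [mul_sub, sub_mul, mul_assoc]
  rw [this, hu]
  simp

theorem zpow_mem_weightSpace {a : R} {u : Rˣ} {l : ℤ} (hu : (u : R) ∈ weightSpace 𝕜 a l) (k : ℤ) :
    (↑(u ^ k) : R) ∈ weightSpace 𝕜 a (k * l) := by
  induction k with
  | zero => simp [mem_weightSpace_zero]
  | succ k ih =>
    rw [zpow_add_one, Units.val_mul, add_mul, one_mul]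
    exact mul_mem_weightSpace ih hu
  | pred k ih =>
    rw [zpow_sub_one, Units.val_mul, sub_mul, one_mul]
    exact mul_mem_weightSpace ih (inv_mem_weightSpace hu)

theorem zpow_sub_one_mem_span (u : Rˣ) (k : ℤ) :
    (↑(u ^ k) : R) - 1 ∈ Submodule.span R {(u : R) - 1} := by
  have hu (r : R) : r * (u - 1) ∈ Submodule.span R {(u : R) - 1} :=
    Submodule.smul_mem _ r (Submodule.mem_span_singleton_self _)
  induction k with
  | zero => simp
  | succ k ih =>
    convert add_mem (hu (↑(u ^ (k : ℤ)) : R)) ih using 1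
    rw [zpow_add_one, Units.val_mul]
    noncomm_ring
  | pred k ih =>
    convert sub_mem ih (hu (↑(u ^ (-(k : ℤ) - 1)) : R)) using 1
    rw [mul_sub, ← Units.val_mul, ← zpow_add_one, sub_add_cancel]
    noncomm_ring

variable (𝕜) in
/-- If `ad a` is diagonalizable with integral eigenvalues, there is a linear operator multiplying
the elements of weight `k` by `u ^ k` on the right. -/
theorem exists_weightTwist [CharZero 𝕜] (a : R) (ha : ⨆ k, weightSpace 𝕜 a k = ⊤) (u : Rˣ) :
    ∃ T : R →ₗ[𝕜] R, ∀ k, ∀ x ∈ weightSpace 𝕜 a k, T x = x * ↑(u ^ k) := by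
  have hind : iSupIndep (weightSpace 𝕜 a) :=
    (Module.End.eigenspaces_iSupIndep (LinearMap.mulLeft 𝕜 a - LinearMap.mulRight 𝕜 a)).comp
      (f := fun k : ℤ => (k : 𝕜)) Int.cast_injective
  have hint := DirectSum.isInternal_submodule_of_iSupIndep_of_iSup_eq_top hind ha
  let E := LinearEquiv.ofBijective (DirectSum.coeLinearMap (weightSpace 𝕜 a)) hint
  refine ⟨(DirectSum.toModule 𝕜 ℤ R fun k => (LinearMap.mulRight 𝕜 (↑(u ^ k) : R)).comp
    (weightSpace 𝕜 a k).subtype).comp E.symm.toLinearMap, fun k x hx => ?_⟩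
  have : E.symm x = DirectSum.lof 𝕜 ℤ (fun k => weightSpace 𝕜 a k) k ⟨x, hx⟩ := by
    rw [LinearEquiv.symm_apply_eq]
    exact (DirectSum.coeLinearMap_lof _ k ⟨x, hx⟩).symm
  simp [this]

/-- Let `u` have weight `-1`. The twist identifies right multiplication by `u` with the identity,
takes values in the centralizer of `a`, and does not move anything in the quotient by
`R (u - 1)`. -/
theorem exists_linearMap_centralizer [CharZero 𝕜] {a : R} (ha : ⨆ k, weightSpace 𝕜 a k = ⊤) {u : Rˣ}
    (hu : (u : R) ∈ weightSpace 𝕜 a (-1)) :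
    ∃ T : R →ₗ[𝕜] R, (∀ x, Commute a (T x)) ∧ (∀ x, Commute a x → T x = x) ∧
      (∀ x, T (x * u) = T x) ∧ (∀ x, T (u * x) * u = u * T x) ∧
      (∀ b x, Commute a b → Commute ↑u b → T (b * x) = b * T x ∧ T (x * b) = T x * b) ∧
      (∀ x, T x - x ∈ Submodule.span R {(u : R) - 1}) := by
  obtain ⟨T, hT⟩ := exists_weightTwist 𝕜 a ha u
  have ind {p : R → Prop} (h : ∀ k, ∀ x ∈ weightSpace 𝕜 a k, p x) (h0 : p 0)
      (hadd : ∀ x y, p x → p y → p (x + y)) (x : R) :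
      p x :=
    Submodule.iSup_induction (weightSpace 𝕜 a) (motive := p) (ha ▸ Submodule.mem_top) h h0 hadd
  refine ⟨T, ?_, ?_, ?_, ?_, ?_, ?_⟩
  · refine ind (fun k x hx => ?_) (by simp) fun x y hx hy => by
      rw [map_add]; exact hx.add_right hy
    rw [hT k x hx, ← mem_weightSpace_zero (𝕜 := 𝕜)]
    -- The weights k and k * (-1) add up to 0.
    simpa using mul_mem_weightSpace hx (zpow_mem_weightSpace hu k)
  · intro x hx
    simpa using hT 0 x (mem_weightSpace_zero.2 hx)
  · refine ind (fun k x hx => ?_) (by simp) fun x y hx hy => by rw [add_mul, map_add, map_add, hx, hy]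
    rw [hT k x hx, hT _ _ (mul_mem_weightSpace hx hu), mul_assoc, ← Units.val_mul, ← zpow_one_add]
    congr 3
    ring
  · refine ind (fun k x hx => ?_) (by simp) fun x y hx hy => by
      rw [mul_add, map_add, map_add, add_mul, hx, hy, mul_add]
    rw [hT k x hx, hT _ _ (mul_mem_weightSpace hu hx), mul_assoc, ← Units.val_mul, ← zpow_add_one,
      mul_assoc]
    congr 4
    ring
  · intro b x hab hub
    have hb := mem_weightSpace_zero (𝕜 := 𝕜).2 hab
    revert x
    refine ind (fun k x hx => ⟨?_, ?_⟩) (by simp) fun x y hx hy => by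
      rw [mul_add, add_mul, map_add, map_add, map_add, hx.1, hx.2, hy.1, hy.2, mul_add, add_mul]
      exact ⟨rfl, rfl⟩
    · rw [hT k x hx, hT k _ (by simpa using mul_mem_weightSpace hb hx), mul_assoc]
    · rw [hT k x hx, hT k _ (by simpa using mul_mem_weightSpace hx hb), mul_assoc, mul_assoc]
      congr 1
      exact (hub.units_zpow_left k).eq.symm
  · refine ind (fun k x hx => ?_) (by simp) fun x y hx hy => by
      rw [map_add, add_sub_add_comm]; exact add_mem hx hy
    rw [hT k x hx]
    simpa [mul_sub] using Submodule.smul_mem _ x (zpow_sub_one_mem_span u k)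

end Weights

/-! ### Whittaker vectors and elements commuting with all `a i` -/

section Whittaker

variable {𝕜 R M ι : Type*} [Field 𝕜] [CharZero 𝕜] [Ring R] [Algebra 𝕜 R]
  {a : ι → R} {u : ι → Rˣ}

/-- An element commuting with all `a i` and lying in the left ideal generated by the `u i - 1`
vanishes. -/
theorem eq_zero_of_commute_of_mem_span [Fintype ι] (ha : ∀ i, ⨆ k, weightSpace 𝕜 (a i) k = ⊤)
    (hu : ∀ i, (u i : R) ∈ weightSpace 𝕜 (a i) (-1))
    (hau : ∀ i j, i ≠ j → Commute (a i) (u j : R)) (huu : ∀ i j, Commute (u i : R) (u j : R))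
    {x : R} (hx : ∀ i, Commute (a i) x)
    (h : x ∈ Submodule.span R (Set.range fun i => (u i : R) - 1)) : x = 0 := by
  classical
  obtain ⟨c, hc⟩ := (Submodule.mem_span_range_iff_exists_fun R).1 h
  -- The coefficients must vary in the induction: the projection for j fixes x, kills the j-th
  -- summand and replaces every other `c i` by `T (c i)`.
  have key (s : Finset ι) : ∀ c : ι → R, ∑ i ∈ s, c i * ((u i : R) - 1) = x → x = 0 := by
    induction s using Finset.induction_on with
    | empty => intro c hc; simpa using hc.symm
    | insert j s hj ih =>
      intro c hc
      obtain ⟨T, -, hT1, hT2, -, hT3, -⟩ := exists_linearMap_centralizer (ha j) (hu j)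
      refine ih (fun i => T (c i)) ?_
      rw [← hT1 x (hx j), ← hc, Finset.sum_insert hj, map_add, mul_sub, map_sub, hT2, mul_one,
        sub_self, zero_add, map_sum]
      refine Finset.sum_congr rfl fun i hi => ?_
      have hij : j ≠ i := fun h => hj (h ▸ hi)
      exact ((hT3 _ _ ((hau j i hij).sub_right (Commute.one_right _))
        ((huu j i).sub_right (Commute.one_right _))).2).symm
  exact key Finset.univ c hc

/-- Every vector `x • m` fixed by all `u i` comes from an element commuting with all `a i` and all
`u i`. -/
theorem exists_commute_smul_eq [AddCommGroup M] [Module R M] {m : M} [Fintype ι]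
    (ha : ∀ i, ⨆ k, weightSpace 𝕜 (a i) k = ⊤)
    (hu : ∀ i, (u i : R) ∈ weightSpace 𝕜 (a i) (-1))
    (hau : ∀ i j, i ≠ j → Commute (a i) (u j : R)) (huu : ∀ i j, Commute (u i : R) (u j : R))
    (haa : ∀ i j, Commute (a i) (a j)) (hnil : ∀ i, AdLocNilp (u i : R))
    (hm : ∀ i, (u i : R) • m = m) {x : R} (hx : ∀ i, (u i : R) • x • m = x • m) :
    ∃ w : R, (∀ i, Commute (a i) w) ∧ (∀ i, Commute (u i : R) w) ∧ w • m = x • m := by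
  classical
  have commuting_units (s : Finset ι) : ∃ w : R, (∀ i ∈ s, Commute (u i : R) w) ∧ w • m = x • m := by
    induction s using Finset.induction_on with
    | empty => exact ⟨x, by simp, rfl⟩
    | insert j s hj ih =>
      obtain ⟨w, hw, hwx⟩ := ih
      obtain ⟨N, hN⟩ := hnil j w
      -- Weight -1 means [u, a] = u, hence [u, a u⁻¹] = 1.
      have hy : adMap (u j : R) (a j * ↑(u j)⁻¹) = 1 := by
        have h1 := mem_weightSpace.1 (hu j)
        have h2 : (u j : R) * a j = a j * u j + u j := by
          simp only [Int.cast_neg, Int.cast_one, neg_smul, one_smul] at h1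
          rw [sub_eq_iff_eq_add] at h1
          rw [h1]; abel
        rw [adMap_apply, ← mul_assoc, h2]
        simp [add_mul, mul_assoc]
      refine ⟨slice 𝕜 (u j : R) (a j * ↑(u j)⁻¹) N w, ?_, ?_⟩
      · intro i hi
        by_cases hij : i = j
        · subst hij
          rw [← adMap_eq_zero_iff, adMap_slice hy, iterate_adMap_mono _ (Nat.le_succ N) hN]
          simp
        · exact commute_slice (huu i j) (((hau j i (Ne.symm hij)).symm).mul_right
            ((huu i j).units_inv_right)) (hw i (Finset.mem_of_mem_insert_of_ne hi hij)) N
      · rw [slice_smul (hm j) (by rw [hwx, hx]), hwx]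
  obtain ⟨w, hw, hwx⟩ := commuting_units Finset.univ
  -- Projecting after slicing is safe: each projection preserves commutation with all the units and
  -- with the `a i` already treated.
  have commuting_both (s : Finset ι) : ∃ w : R, (∀ i ∈ s, Commute (a i) w) ∧
      (∀ i, Commute (u i : R) w) ∧ w • m = x • m := by
    induction s using Finset.induction_on with
    | empty => exact ⟨w, by simp, fun i => hw i (Finset.mem_univ i), hwx⟩
    | insert j s hj ih =>
      obtain ⟨w, hwa, hwu, hwx⟩ := ih
      obtain ⟨T, hT1, -, hT2, hT3, hT4, hT5⟩ := exists_linearMap_centralizer (ha j) (hu j)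
      refine ⟨T w, fun i hi => ?_, fun i => ?_, ?_⟩
      rotate_left 2
      · obtain ⟨c, hc⟩ := Submodule.mem_span_singleton.1 (hT5 w)
        rw [← hwx, ← sub_eq_zero, ← sub_smul, ← hc, smul_eq_mul, mul_smul, sub_smul, hm, one_smul,
          sub_self, smul_zero]
      · by_cases hij : i = j
        · subst hij; exact hT1 w
        · obtain ⟨h1, h2⟩ := hT4 (a i) w (haa j i) (hau i j hij).symm
          exact h1.symm.trans
            ((congrArg T (hwa i (Finset.mem_of_mem_insert_of_ne hi hij)).eq).trans h2)
      · by_cases hij : i = j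
        · subst hij
          -- Since u w = w u, this reads T(w u) u = u T(w), and T(w u) = T(w).
          have := hT3 w
          rw [(hwu i).eq, hT2] at this
          exact this.symm
        · obtain ⟨h1, h2⟩ := hT4 (u i : R) w (hau j i (Ne.symm hij)) (huu j i)
          exact h1.symm.trans ((congrArg T (hwu i).eq).trans h2)
  obtain ⟨w, h1, h2, h3⟩ := commuting_both Finset.univ
  exact ⟨w, fun i => h1 i (Finset.mem_univ i), h2, h3⟩

end Whittaker

/-! ### Locally finite subalgebras -/

section Subalgebras

variable {𝕜 R : Type*} [Field 𝕜] [Ring R] [Algebra 𝕜 R]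

variable (𝕜) in
/-- The subalgebra of all sums of weight vectors for the inner derivation of `a`. -/
def weightSubalgebra (a : R) : Subalgebra 𝕜 R :=
  { ⨆ k, weightSpace 𝕜 a k with
    mul_mem' := by
      intro x y (hx : x ∈ ⨆ k, weightSpace 𝕜 a k) (hy : y ∈ ⨆ k, weightSpace 𝕜 a k)
      change x * y ∈ ⨆ k, weightSpace 𝕜 a k
      refine Submodule.iSup_induction _ (motive := fun x => x * y ∈ _) hx (fun k x hx => ?_)
        (by simp) fun x x' hx hx' => by rw [add_mul]; exact add_mem hx hx'
      refine Submodule.iSup_induction _ (motive := fun y => x * y ∈ _) hy (fun l y hy => ?_)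
        (by simp) fun y y' hy hy' => by rw [mul_add]; exact add_mem hy hy'
      exact Submodule.mem_iSup_of_mem (k + l) (mul_mem_weightSpace hx hy)
    algebraMap_mem' := fun c => Submodule.mem_iSup_of_mem (p := weightSpace 𝕜 a) 0
      (mem_weightSpace_zero.2 (Algebra.commutes c a).symm) }

theorem mem_weightSubalgebra {a x : R} :
    x ∈ weightSubalgebra 𝕜 a ↔ x ∈ ⨆ k, weightSpace 𝕜 a k := Iff.rfl

theorem mem_weightSubalgebra_of_mem {a x : R} {k : ℤ} (hx : x ∈ weightSpace 𝕜 a k) :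
    x ∈ weightSubalgebra 𝕜 a :=
  Submodule.mem_iSup_of_mem (p := weightSpace 𝕜 a) k hx

variable (𝕜) in
/-- The subalgebra of all elements annihilated by a power of the inner derivation of `a`. -/
def adNilpSubalgebra (a : R) : Subalgebra 𝕜 R where
  carrier := {r | ∃ m : ℕ, (adMap a)^[m] r = 0}
  mul_mem' := by
    rintro x y ⟨p, hp⟩ ⟨q, hq⟩
    exact ⟨p + q, iterate_adMap_mul a _ p q x y rfl hp hq⟩
  add_mem' := by
    rintro x y ⟨p, hp⟩ ⟨q, hq⟩
    refine ⟨p + q, ?_⟩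
    rw [iterate_map_add, iterate_adMap_mono a (Nat.le_add_right p q) hp,
      iterate_adMap_mono a (Nat.le_add_left q p) hq, add_zero]
  algebraMap_mem' := fun c => ⟨1, by simp [adMap_apply, Algebra.commutes]⟩

theorem bijective_of_sub_one_locally_nilpotent {M : Type*} [AddCommGroup M] [Module 𝕜 M]
    (f : Module.End 𝕜 M) (hf : ∀ x, ∃ m : ℕ, ((f - 1) ^ m) x = 0) : Function.Bijective f := by
  constructor
  · rw [injective_iff_map_eq_zero]
    intro x hx
    obtain ⟨m, hm⟩ := hf x
    induction m with
    | zero => simpa using hm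
    | succ m ih =>
      refine ih ?_
      rw [pow_succ, Module.End.mul_apply, LinearMap.sub_apply, hx] at hm
      simpa using hm
  · intro x
    obtain ⟨m, hm⟩ := hf x
    induction m generalizing x with
    | zero => exact ⟨0, by simpa using hm.symm⟩
    | succ m ih =>
      obtain ⟨y, hy⟩ := ih ((f - 1) x) (by rwa [pow_succ] at hm)
      -- Here f y = (f - 1) x = f x - x, so f (x - y) = x.
      exact ⟨x - y, by simp [hy]⟩

end Subalgebras

/-! ### The structure of `U_S` -/

section Localization

variable {n : ℕ}

theorem toUS_lie (X Y : SL n) : toUS ⁅X, Y⁆ = toUS X * toUS Y - toUS Y * toUS X := by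
  change OreLocalization.numeratorRingHom (toU n ⁅X, Y⁆) = _
  rw [LieHom.map_lie, LieRing.of_associative_ring_bracket, map_sub, map_mul, map_mul]
  rfl

variable (n) in
/-- The canonical map `U(sl_{n+1}) → U_S` as an algebra homomorphism. -/
def numAlgHom : U n →ₐ[ℂ] US n :=
  { OreLocalization.numeratorRingHom with commutes' := fun _ => rfl }

theorem numAlgHom_toU (X : SL n) : numAlgHom n (toU n X) = toUS X := rfl

theorem toUS_zero : toUS (0 : SL n) = 0 :=
  map_zero ((numAlgHom n).toLinearMap ∘ₗ (toU n : SL n →ₗ[ℂ] U n))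

theorem lie_h_e0_same (i : Fin n) : ⁅h i, e0 i⁆ = (-1 : ℂ) • e0 i := by
  apply Subtype.ext
  rw [sl_bracket]
  simp [h, e0, sub_mul, mul_sub, Matrix.single_mul_single_of_ne, Fin.succ_ne_zero]
  abel

theorem lie_h_e0_of_ne {i j : Fin n} (hij : i ≠ j) : ⁅h i, e0 j⁆ = 0 := by
  apply Subtype.ext
  rw [sl_bracket]
  have : j.succ ≠ i.succ := fun h => hij (Fin.succ_injective n h).symm
  simp [h, e0, sub_mul, mul_sub, Matrix.single_mul_single_of_ne, Fin.succ_ne_zero, this]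

theorem lie_h_h (i j : Fin n) : ⁅(h i : SL n), h j⁆ = 0 := by
  apply Subtype.ext
  rw [sl_bracket]
  by_cases hij : i = j
  · subst hij; simp
  · have : i.succ ≠ j.succ := fun h => hij (Fin.succ_injective n h)
    simp only [h, sub_mul, mul_sub, Matrix.single_mul_single_of_ne _ _ _ _ this,
      Matrix.single_mul_single_of_ne _ _ _ _ this.symm, smul_mul_assoc, mul_smul_comm, one_mul,
      mul_one, ZeroMemClass.coe_zero]
    module

/-- Up to a scalar matrix, `h i` is the idempotent e_ii, and ad of an idempotent has eigenvalues 0,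
1, -1 only. -/
theorem lie_h_cube (i : Fin n) (X : SL n) : ⁅h i, ⁅h i, ⁅h i, X⁆⁆⁆ = ⁅h i, X⁆ := by
  have key (c : ℂ) (a x : Matrix (Fin (n + 1)) (Fin (n + 1)) ℂ) (y) (hy : y = a - c • 1) :
      y * x - x * y = a * x - x * a := by
    subst hy; simp [sub_mul, mul_sub]
  have hsq : Matrix.single i.succ i.succ (1 : ℂ) * Matrix.single i.succ i.succ 1 =
      Matrix.single i.succ i.succ 1 := by simp
  have hh (x) := key _ (Matrix.single i.succ i.succ (1 : ℂ)) x (h i).val rfl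
  apply Subtype.ext
  simp only [sl_bracket, hh]
  generalize Matrix.single i.succ i.succ (1 : ℂ) = a at hsq
  generalize X.val = x
  have h2 : ∀ y, a * (a * y) = a * y := fun y => by rw [← mul_assoc, hsq]
  simp only [mul_sub, sub_mul, mul_assoc, h2, hsq]
  abel

theorem commute_e0 (i j : Fin n) : Commute (toUS (e0 i)) (toUS (e0 j)) := by
  rw [← adMap_eq_zero_iff, adMap_apply, ← toUS_lie, lie_e0_e0]
  exact toUS_zero

theorem commute_h (i j : Fin n) : Commute (toUS (h i)) (toUS (h j)) := by
  rw [← adMap_eq_zero_iff, adMap_apply, ← toUS_lie, lie_h_h]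
  exact toUS_zero

theorem commute_h_e0 {i j : Fin n} (hij : i ≠ j) : Commute (toUS (h i)) (toUS (e0 j)) := by
  rw [← adMap_eq_zero_iff, adMap_apply, ← toUS_lie, lie_h_e0_of_ne hij]
  exact toUS_zero

theorem toUS_mem_weightSpace {X Y : SL n} {k : ℤ} (hXY : ⁅X, Y⁆ = (k : ℂ) • Y) :
    toUS Y ∈ weightSpace ℂ (toUS X) k := by
  rw [mem_weightSpace, ← toUS_lie, hXY]
  simp [← numAlgHom_toU]

/-- The unit `e_{0k}` of `U_S`. -/
def e0Unit (k : Fin n) : (US n)ˣ := ⟨toUS (e0 k), e0inv k, mul_e0inv k, e0inv_mul k⟩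

theorem e0_mem_weightSpace (i : Fin n) : toUS (e0 i) ∈ weightSpace ℂ (toUS (h i)) (-1) :=
  toUS_mem_weightSpace (by simpa using lie_h_e0_same i)

theorem exists_inverse_mem (A : Subalgebra ℂ (US n)) (hA : ∀ k, e0inv k ∈ A) {s : U n}
    (hs : s ∈ S n) : ∃ v ∈ A, v * numAlgHom n s = 1 := by
  induction hs using Submonoid.closure_induction with
  | mem s hs => obtain ⟨k, rfl⟩ := hs; exact ⟨_, hA k, e0inv_mul k⟩
  | one => exact ⟨1, one_mem A, by simp⟩
  | mul s t _ _ ihs iht =>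
    obtain ⟨v, hv, h1⟩ := ihs
    obtain ⟨w, hw, h2⟩ := iht
    exact ⟨w * v, mul_mem hw hv, by rw [map_mul, mul_assoc, ← mul_assoc v, h1, one_mul, h2]⟩

/-- Every element of `U_S` is a left fraction. -/
theorem exists_mul_eq_numAlgHom (x : US n) :
    ∃ s ∈ S n, ∃ r : U n, numAlgHom n s * x = numAlgHom n r := by
  induction x using OreLocalization.ind with
  | _ r s =>
    refine ⟨s, s.2, r, ?_⟩
    exact OreLocalization.mul_cancel

theorem range_numAlgHom_le (A : Subalgebra ℂ (US n)) (hA : ∀ X, toUS X ∈ A) (r : U n) :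
    numAlgHom n r ∈ A := by
  let F : U n →ₐ[ℂ] A := UniversalEnvelopingAlgebra.lift ℂ
    { toFun := fun X => ⟨toUS X, hA X⟩
      map_add' := fun X Y => Subtype.ext (map_add ((numAlgHom n).toLinearMap ∘ₗ (toU n)) X Y)
      map_smul' := fun c X => Subtype.ext (map_smul ((numAlgHom n).toLinearMap ∘ₗ (toU n)) c X)
      map_lie' := fun {X Y} => Subtype.ext (toUS_lie X Y) }
  have hF : A.val.comp F = numAlgHom n := by
    apply UniversalEnvelopingAlgebra.hom_ext
    ext X
    simp only [LieHom.coe_comp, Function.comp_apply, AlgHom.coe_toLieHom, AlgHom.coe_comp]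
    rw [UniversalEnvelopingAlgebra.lift_ι_apply]
    rfl
  rw [← hF]
  exact (F r).2

/-- `U_S` is generated by `sl_{n+1}` and the inverses `e_{0k}^{-1}`. -/
theorem subalgebra_eq_top (A : Subalgebra ℂ (US n)) (hA : ∀ X, toUS X ∈ A)
    (hinv : ∀ k, e0inv k ∈ A) : A = ⊤ := by
  rw [eq_top_iff]
  rintro x -
  obtain ⟨s, hs, r, hx⟩ := exists_mul_eq_numAlgHom x
  obtain ⟨v, hv, hvs⟩ := exists_inverse_mem A hinv hs
  have : x = v * numAlgHom n r := by rw [← hx, ← mul_assoc, hvs, one_mul]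
  rw [this]
  exact mul_mem hv (range_numAlgHom_le A hA r)

/-- Sums of weight vectors form a subalgebra, so it suffices to treat the generators of U_S. -/
theorem iSup_weightSpace_h (i : Fin n) : ⨆ k, weightSpace ℂ (toUS (h i)) k = ⊤ := by
  have hX (X : SL n) : toUS X ∈ weightSubalgebra ℂ (toUS (h i)) := by
    -- The components of eigenvalue 0, 1 and -1, read off from (ad h_i)^3 = ad h_i.
    have hX : X = (X - ⁅h i, ⁅h i, X⁆⁆) +
        ((2⁻¹ : ℂ) • (⁅h i, ⁅h i, X⁆⁆ + ⁅h i, X⁆) +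
          (2⁻¹ : ℂ) • (⁅h i, ⁅h i, X⁆⁆ - ⁅h i, X⁆)) := by
      module
    have hadd (Y Z : SL n) : toUS (Y + Z) = toUS Y + toUS Z := by
      simp [← numAlgHom_toU]
    rw [hX, hadd, hadd]
    refine add_mem ?_ (add_mem ?_ ?_)
    · refine mem_weightSubalgebra_of_mem (toUS_mem_weightSpace (k := 0) ?_)
      rw [lie_sub, lie_h_cube]; simp
    · refine mem_weightSubalgebra_of_mem (toUS_mem_weightSpace (k := 1) ?_)
      rw [lie_smul, lie_add, lie_h_cube]; push_cast; module
    · refine mem_weightSubalgebra_of_mem (toUS_mem_weightSpace (k := -1) ?_)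
      rw [lie_smul, lie_sub, lie_h_cube]; push_cast; module
  have := subalgebra_eq_top (weightSubalgebra ℂ (toUS (h i))) hX fun k => ?_
  · rw [eq_top_iff]
    rintro x -
    rw [← mem_weightSubalgebra, this]
    trivial
  · by_cases hik : i = k
    · subst hik
      exact mem_weightSubalgebra_of_mem (inv_mem_weightSpace (u := e0Unit i) (e0_mem_weightSpace i))
    · exact mem_weightSubalgebra_of_mem (mem_weightSpace_zero.2
        (Commute.units_inv_right (u := e0Unit k) (commute_h_e0 hik)))

theorem adLocNilp_toUS_e0 (i : Fin n) : AdLocNilp (toUS (e0 i)) := by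
  have := subalgebra_eq_top (adNilpSubalgebra ℂ (toUS (e0 i))) (fun X => ⟨3, ?_⟩)
    fun k => ⟨1, adMap_eq_zero_iff.2 (Commute.units_inv_right (u := e0Unit k) (commute_e0 i k))⟩
  · intro x
    exact (this ▸ Algebra.mem_top : x ∈ adNilpSubalgebra ℂ (toUS (e0 i)))
  · simp only [Function.iterate_succ, Function.iterate_zero, Function.comp_apply, id_eq,
      adMap_apply, ← toUS_lie, ad_e0_cube]
    exact toUS_zero

theorem mem_W_iff {w : US n} :
    w ∈ W n ↔ (∀ i, Commute (toUS (h i)) w) ∧ ∀ i, Commute (toUS (e0 i)) w := by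
  rw [W, Subalgebra.mem_centralizer_iff]
  constructor
  · exact fun hw => ⟨fun i => hw _ (Algebra.subset_adjoin (.inl (.inl ⟨i, rfl⟩))),
      fun i => hw _ (Algebra.subset_adjoin (.inl (.inr ⟨i, rfl⟩)))⟩
  · rintro ⟨h1, h2⟩ b hb
    have hB : B n ≤ Subalgebra.centralizer ℂ {w} := by
      refine Algebra.adjoin_le ?_
      rintro _ ((⟨i, rfl⟩ | ⟨i, rfl⟩) | ⟨i, rfl⟩) _ rfl
      · exact (h1 i).symm
      · exact (h2 i).symm
      · exact (Commute.units_inv_left (u := e0Unit i) (h2 i)).symm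
    exact (hB hb w rfl).symm

end Localization

/-! ### The action of `U_S` on the Gelfand–Graev module -/

section Module

variable {n : ℕ}

variable (n) in
/-- The canonical generator of `Q`. -/
def whit : Q n := Submodule.Quotient.mk 1

theorem smul_whit (r : U n) : r • whit n = Submodule.Quotient.mk r := by
  rw [whit, ← Submodule.Quotient.mk_smul, smul_eq_mul, mul_one]

theorem exists_smul_whit (q : Q n) : ∃ r : U n, r • whit n = q := by
  obtain ⟨r, rfl⟩ := Submodule.Quotient.mk_surjective _ q
  exact ⟨r, smul_whit r⟩

theorem smul_whit_eq_zero {r : U n} : r • whit n = 0 ↔ r ∈ whittakerIdeal n := by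
  rw [smul_whit, Submodule.Quotient.mk_eq_zero]

theorem toU_e0_smul_whit (i : Fin n) : toU n (e0 i) • whit n = whit n := by
  have : toU n (e0 i) - 1 ∈ whittakerIdeal n := by
    rw [whittakerIdeal_eq]
    exact Submodule.subset_span ⟨i, rfl⟩
  rwa [← smul_whit_eq_zero, sub_smul, one_smul, sub_eq_zero] at this

/-- Since e_{0i} fixes `whit`, the operator e_{0i} - 1 sends r • `whit` to [e_{0i}, r] • `whit`;
local ad-nilpotency in U(sl_{n+1}) thus makes e_{0i} locally unipotent on `Q`. -/
theorem bijective_e0_smul (i : Fin n) :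
    Function.Bijective (Module.toModuleEnd ℂ (Q n) (toU n (e0 i))) := by
  refine bijective_of_sub_one_locally_nilpotent _ fun q => ?_
  obtain ⟨r, rfl⟩ := exists_smul_whit q
  obtain ⟨m, hm⟩ := adLocNilp_e0 i r
  refine ⟨m, ?_⟩
  have key (m : ℕ) : ((Module.toModuleEnd ℂ (Q n) (toU n (e0 i)) - 1) ^ m) (r • whit n) =
      (adMap (toU n (e0 i)))^[m] r • whit n := by
    induction m with
    | zero => simp
    | succ m ih =>
      rw [pow_succ', Module.End.mul_apply, ih, Function.iterate_succ_apply', adMap_apply, sub_smul,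
        mul_smul, mul_smul, toU_e0_smul_whit]
      rfl
  rw [key, hm, zero_smul]

theorem isUnit_toModuleEnd (s : S n) : IsUnit (Module.toModuleEnd ℂ (Q n) (s : U n)) := by
  obtain ⟨s, hs⟩ := s
  induction hs using Submonoid.closure_induction with
  | mem s hs =>
    obtain ⟨i, rfl⟩ := hs
    exact (Module.End.isUnit_iff _).2 (bijective_e0_smul i)
  | one => simp only [map_one, isUnit_one]
  | mul s t _ _ ihs iht => rw [map_mul]; exact ihs.mul iht

variable (n) in
/-- The elements of `S` act on `Q` by linear automorphisms. -/
def unitsHom : S n →* (Module.End ℂ (Q n))ˣ :=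
  IsUnit.liftRight (((Module.toModuleEnd ℂ (Q n) : U n →+* _) : U n →* _).comp (S n).subtype)
    isUnit_toModuleEnd

theorem coe_unitsHom (s : S n) : Module.toModuleEnd ℂ (Q n) (s : U n) = unitsHom n s :=
  rfl

variable (n) in
/-- The extension to `U_S` of the action of `U(sl_{n+1})` on `Q`. -/
def actionHom : US n →+* Module.End ℂ (Q n) :=
  OreLocalization.universalHom (Module.toModuleEnd ℂ (Q n)) (unitsHom n) coe_unitsHom

theorem actionHom_numAlgHom (r : U n) :
    actionHom n (numAlgHom n r) = Module.toModuleEnd ℂ (Q n) r :=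
  OreLocalization.universalHom_commutes _ _ coe_unitsHom

instance moduleUSQ (n : ℕ) : Module (US n) (Q n) := Module.compHom (Q n) (actionHom n)

theorem numAlgHom_smul (r : U n) (q : Q n) : numAlgHom n r • q = r • q := by
  change actionHom n (numAlgHom n r) q = _
  rw [actionHom_numAlgHom]
  rfl

theorem toUS_smul (X : SL n) (q : Q n) : toUS X • q = toU n X • q := numAlgHom_smul _ q

theorem toUS_e0_smul_whit (i : Fin n) : toUS (e0 i) • whit n = whit n := by
  rw [toUS_smul, toU_e0_smul_whit]

instance isScalarTowerUSQ (n : ℕ) : IsScalarTower ℂ (US n) (Q n) where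
  smul_assoc c x q := by
    have (c : ℂ) (q : Q n) : algebraMap ℂ (US n) c • q = c • q := by
      rw [← (numAlgHom n).commutes, numAlgHom_smul, algebraMap_smul]
    rw [Algebra.smul_def, mul_smul, this]

/-- `U`-linear endomorphisms of `Q` are `U_S`-linear. -/
theorem map_US_smul (f : Module.End (U n) (Q n)) (x : US n) (q : Q n) : f (x • q) = x • f q := by
  obtain ⟨s, hs, r, hx⟩ := exists_mul_eq_numAlgHom x
  obtain ⟨v, -, hv⟩ := exists_inverse_mem ⊤ (fun _ => trivial) hs
  have h1 : numAlgHom n s • f (x • q) = numAlgHom n s • x • f q := by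
    rw [numAlgHom_smul, ← map_smul, ← numAlgHom_smul, ← mul_smul, ← mul_smul, hx, numAlgHom_smul,
      numAlgHom_smul, map_smul]
  rw [← one_smul (US n) (f (x • q)), ← hv, mul_smul, h1, ← mul_smul, hv, one_smul]

/-- Clearing the denominator of x gives an element of U(sl_{n+1}) that kills `whit`, hence lies in
`whittakerIdeal`; a left ideal of U_S absorbs the inverse denominator. -/
theorem mem_span_of_smul_whit_eq_zero {x : US n} (hx : x • whit n = 0) :
    x ∈ Submodule.span (US n) (Set.range fun i : Fin n => toUS (e0 i) - 1) := by
  obtain ⟨s, hs, r, hxr⟩ := exists_mul_eq_numAlgHom x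
  obtain ⟨v, -, hv⟩ := exists_inverse_mem ⊤ (fun _ => trivial) hs
  have hr : r ∈ whittakerIdeal n := by
    rw [← smul_whit_eq_zero, ← numAlgHom_smul, ← hxr, mul_smul, hx, smul_zero]
  have hr' : numAlgHom n r ∈
      Submodule.span (US n) (Set.range fun i : Fin n => toUS (e0 i) - 1) := by
    clear hxr
    rw [whittakerIdeal_eq] at hr
    induction hr using Submodule.span_induction with
    | mem y hy =>
      obtain ⟨i, rfl⟩ := hy
      refine Submodule.subset_span ⟨i, ?_⟩
      simp only [map_sub, map_one, numAlgHom_toU]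
    | zero => simp
    | add y z _ _ hy hz => rw [map_add]; exact add_mem hy hz
    | smul a y _ hy => rw [smul_eq_mul, map_mul]; exact Submodule.smul_mem _ _ hy
  have : x = v • numAlgHom n r := by rw [smul_eq_mul, ← hxr, ← mul_assoc, hv, one_mul]
  rw [this]
  exact Submodule.smul_mem _ _ hr'

/-! ### The isomorphism -/

theorem whittakerIdeal_le_ker (w : W n) :
    whittakerIdeal n ≤
      LinearMap.ker (LinearMap.toSpanSingleton (U n) (Q n) ((w : US n) • whit n)) := by
  refine (whittakerIdeal_eq n).trans_le (Submodule.span_le.2 ?_)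
  rintro _ ⟨i, rfl⟩
  have := (mem_W_iff.1 w.2).2 i
  simp only [SetLike.mem_coe, LinearMap.mem_ker, LinearMap.toSpanSingleton_apply]
  rw [sub_smul, one_smul, ← toUS_smul, ← mul_smul, this.eq, mul_smul, toUS_e0_smul_whit, sub_self]

/-- The endomorphism of `Q` given by right multiplication by `w ∈ W`. -/
def rightMul (w : W n) : Module.End (U n) (Q n) :=
  (whittakerIdeal n).liftQ (LinearMap.toSpanSingleton (U n) (Q n) ((w : US n) • whit n))
    (whittakerIdeal_le_ker w)

theorem rightMul_whit (w : W n) : rightMul w (whit n) = (w : US n) • whit n :=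
  (Submodule.liftQ_apply _ _ _).trans (one_smul _ _)

theorem end_ext {f g : Module.End (U n) (Q n)} (hfg : f (whit n) = g (whit n)) : f = g := by
  refine LinearMap.ext fun q => ?_
  obtain ⟨r, rfl⟩ := exists_smul_whit q
  rw [map_smul, map_smul, hfg]

variable (n) in
/-- Right multiplication as an algebra homomorphism `W → W(e)`. -/
def rightMulHom : W n →ₐ[ℂ] FiniteW n :=
  AlgHom.ofLinearMap
    { toFun := fun w => MulOpposite.op (rightMul w)
      map_add' := fun w w' => MulOpposite.unop_injective <| end_ext <| by
        simp [rightMul_whit, add_smul]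
      map_smul' := fun c w => MulOpposite.unop_injective <| end_ext <| by
        simp [rightMul_whit] }
    (MulOpposite.unop_injective <| end_ext <| by simp [rightMul_whit])
    -- `rightMul w'` sends w • `whit` to w • w' • `whit`, so composition reverses products; this is
    -- why the opposite algebra appears.
    fun w w' => MulOpposite.unop_injective <| end_ext <| by
      simp [rightMul_whit, map_US_smul, mul_smul]

theorem rightMulHom_whit (w : W n) :
    (rightMulHom n w).unop (whit n) = (w : US n) • whit n := rightMul_whit w

theorem bijective_rightMulHom (n : ℕ) : Function.Bijective (rightMulHom n) := by
  have hau (i j : Fin n) (hij : i ≠ j) : Commute (toUS (h i)) (e0Unit j : US n) := commute_h_e0 hij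
  have huu (i j : Fin n) : Commute (e0Unit i : US n) (e0Unit j : US n) := commute_e0 i j
  constructor
  · rw [injective_iff_map_eq_zero]
    intro w hw
    have h0 : (w : US n) • whit n = 0 := by rw [← rightMulHom_whit, hw]; rfl
    exact Subtype.ext (eq_zero_of_commute_of_mem_span (u := e0Unit) iSup_weightSpace_h
      e0_mem_weightSpace hau huu (mem_W_iff.1 w.2).1 (mem_span_of_smul_whit_eq_zero h0))
  · intro f
    obtain ⟨r, hr⟩ := exists_smul_whit (f.unop (whit n))
    rw [← numAlgHom_smul] at hr
    -- By linearity, the image of `whit` under an endomorphism is again fixed by every e_{0i}.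
    obtain ⟨w, h1, h2, h3⟩ := exists_commute_smul_eq (u := e0Unit) (m := whit n)
      (x := numAlgHom n r) iSup_weightSpace_h e0_mem_weightSpace hau huu commute_h
      adLocNilp_toUS_e0 toUS_e0_smul_whit fun i => by
        change toUS (e0 i) • _ = _
        rw [hr, ← map_US_smul, toUS_e0_smul_whit]
    refine ⟨⟨w, mem_W_iff.2 ⟨h1, h2⟩⟩, MulOpposite.unop_injective (end_ext ?_)⟩
    rw [rightMulHom_whit, h3, hr]

end Module

end MinimalWAlgebra

end

theorem theorem2p3 (n : ℕ) (hn : 2 ≤ n) :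
    Nonempty (MinimalWAlgebra.W n ≃ₐ[ℂ] MinimalWAlgebra.FiniteW n) :=
  ⟨AlgEquiv.ofBijective (MinimalWAlgebra.rightMulHom n) (MinimalWAlgebra.bijective_rightMulHom n)⟩
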